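/- For a permutation $\sigma=\sigma_1\cdots\sigma_n$ of $\{1,\dots,n\}$ put $\sigma_0=\sigma_{n+1}=0$, and let $\mathrm{M}(\sigma)$, $\mathrm{V}(\sigma)$, $\mathrm{da}(\sigma)$, $\mathrm{dd}(\sigma)$ be the numbers of indices $i\in\{1,\dots,n\}$ with, respectively, $\sigma_{i-1}<\sigma_i>\sigma_{i+1}$ (peaks), $\sigma_{i-1}>\sigma_i<\sigma_{i+1}$ (valleys), $\sigma_{i-1}<\sigma_i<\sigma_{i+1}$ (double ascents), $\sigma_{i-1}>\sigma_i>\sigma_{i+1}$ (double descents). Let $\mathrm{lma}(\sigma)$, $\mathrm{rma}(\sigma)$ and $\mathrm{inv}(\sigma)$ be the numbers of left-to-right maxima, right-to-left maxima and inversions of $\sigma$, and for $n\ge 1$ let $$P_n(u_1,u_2,u_3,u_4|\alpha,\beta;q)=\sum_{\sigma\in\mathfrak S_n}u_1^{\mathrm V(\sigma)}u_2^{\mathrm M(\sigma)-1}u_3^{\mathrm{da}(\sigma)}u_4^{\mathrm{dd}(\sigma)}\alpha^{\mathrm{lma}(\sigma)-1}\beta^{\mathrm{rma}(\sigma)-1}q^{\mathrm{inv}(\sigma)}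 .$$ Let $K$ be a field of characteristic $0$, let $q$ be an indeterminate over $K$, and let $x,y,u_1,u_2,u_3,u_4,\alpha,\beta\in K$ satisfy $x\neq y$, $x+y=u_3+u_4$ and $xy=u_1u_2$. Put $[n]_q!=\prod_{i=1}^n(1+q+\cdots+q^{i-1})$, $\exp_q(t)=\sum_{n\ge0}t^n/[n]_q!$ and $$F(x,y,u,q;t)=u_1\frac{\exp_q((x-u)t)-\exp_q((y-u)t)}{x\exp_q((y-u)t)-y\exp_q((x-u)t)},$$ a formal power series in $t$ over $K(q)$. Then the following identity of formal power series in $t$ over $K(q)$ holds: $$\sum_{n\ge0}P_{n+1}(u_1,u_2,u_3,u_4|\alpha,\beta;q)\frac{t^n}{[n]_q!} =\prod_{k=0}^{\infty}\Big[1-t\alpha q^k(1-q)\big(u_3+u_2F(x,y,u_4,q;tq^{k+1})\big)\Big]^{-1} \cdot\prod_{k=0}^{\infty}\Big[1-\frac{t\beta}{q^k}(q-1)\Big(u_4+u_2F\big(x,y,u_3,\tfrac1q;\tfrac{t}{q^{k}}\big)\Big)\Big]^{-1}.$$ Here the infinite products converge coefficientwise in $t$: the coefficients of the partial products of the first one converge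 to elements of $K(q)$ in the $q$-adic topology of $K(q)$ (that is, $|q|<1$), and those of the second one converge to elements of $K(q)$ in the $q^{-1}$-adic topology (that is, $|1/q|<1$). -/

import Mathlib

open scoped WithZero

namespace StirlingEulerian

/-! ### Permutation statistics

A permutation of `{1, …, n}` is an element of `Equiv.Perm (Fin n)`; its one-line notation is
`σ₁ ⋯ σₙ` with `σᵢ = σ (i - 1) + 1`. -/

/-- The word `σ₀ σ₁ ⋯ σₙ σₙ₊₁` with boundary values `σ₀ = σₙ₊₁ = 0`. -/
def letter {n : ℕ} (σ : Equiv.Perm (Fin n)) (i : ℕ) : ℕ :=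
  if h : 1 ≤ i ∧ i ≤ n then (σ ⟨i - 1, by omega⟩ : ℕ) + 1 else 0

/-- Number of peaks of `σ`, with `σ₀ = σₙ₊₁ = 0`. -/
def peaks {n : ℕ} (σ : Equiv.Perm (Fin n)) : ℕ :=
  ((Finset.Icc 1 n).filter fun i =>
    letter σ (i - 1) < letter σ i ∧ letter σ i > letter σ (i + 1)).card

/-- Number of valleys of `σ`, with `σ₀ = σₙ₊₁ = 0`. -/
def valleys {n : ℕ} (σ : Equiv.Perm (Fin n)) : ℕ :=
  ((Finset.Icc 1 n).filter fun i =>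
    letter σ (i - 1) > letter σ i ∧ letter σ i < letter σ (i + 1)).card

/-- Number of double ascents of `σ`, with `σ₀ = σₙ₊₁ = 0`. -/
def doubleAscents {n : ℕ} (σ : Equiv.Perm (Fin n)) : ℕ :=
  ((Finset.Icc 1 n).filter fun i =>
    letter σ (i - 1) < letter σ i ∧ letter σ i < letter σ (i + 1)).card

/-- Number of double descents of `σ`, with `σ₀ = σₙ₊₁ = 0`. -/
def doubleDescents {n : ℕ} (σ : Equiv.Perm (Fin n)) : ℕ :=
  ((Finset.Icc 1 n).filter fun i =>
    letter σ (i - 1) > letter σ i ∧ letter σ i > letter σ (i + 1)).card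

/-- Number of left-to-right maxima. -/
def lma {n : ℕ} (σ : Equiv.Perm (Fin n)) : ℕ :=
  (Finset.univ.filter fun i : Fin n => ∀ j : Fin n, j < i → σ j < σ i).card

/-- Number of right-to-left maxima. -/
def rma {n : ℕ} (σ : Equiv.Perm (Fin n)) : ℕ :=
  (Finset.univ.filter fun i : Fin n => ∀ j : Fin n, i < j → σ j < σ i).card

/-- Number of inversions. -/
def inv {n : ℕ} (σ : Equiv.Perm (Fin n)) : ℕ :=
  (Finset.univ.filter fun p : Fin n × Fin n => p.1 < p.2 ∧ σ p.1 > σ p.2).card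

/-- The polynomial `P_n(u₁, u₂, u₃, u₄ | α, β; q)`, for `n ≥ 1`; then each `σ` has at least one
peak, one left-to-right maximum and one right-to-left maximum, so no exponent is truncated. -/
def P {A : Type*} [CommRing A] (n : ℕ) (u₁ u₂ u₃ u₄ α β q : A) : A :=
  ∑ σ : Equiv.Perm (Fin n),
    u₁ ^ valleys σ * u₂ ^ (peaks σ - 1) * u₃ ^ doubleAscents σ * u₄ ^ doubleDescents σ *
      α ^ (lma σ - 1) * β ^ (rma σ - 1) * q ^ inv σ

/-! ### `q`-series -/

/-- `[n]_q! = ∏_{i=1}^n (1 + q + ⋯ + q^{i-1})`. -/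
def qFactorial {A : Type*} [CommRing A] (q : A) (n : ℕ) : A :=
  ∏ i ∈ Finset.Icc 1 n, ∑ j ∈ Finset.range i, q ^ j

/-- The power series `exp_q(c t) = ∑ (c t)^n / [n]_q!` in the variable `t`. -/
noncomputable def qExp {L : Type*} [Field L] (q c : L) : PowerSeries L :=
  PowerSeries.mk fun n => c ^ n / qFactorial q n

/-- The Pan–Zeng series in the variable `t` (for `x ≠ y`, so that the denominator has the
invertible constant term `x - y`):
`u₁ (exp_q((x-u)t) - exp_q((y-u)t)) / (x exp_q((y-u)t) - y exp_q((x-u)t))`. -/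
noncomputable def F {L : Type*} [Field L] (u₁ x y u q : L) : PowerSeries L :=
  PowerSeries.C u₁ * (qExp q (x - u) - qExp q (y - u)) *
    (PowerSeries.C x * qExp q (y - u) - PowerSeries.C y * qExp q (x - u))⁻¹

/-- The first factor of `G_k`:
`[1 - t α q^k (1 - q) (u₃ + u₂ F(x, y, u₄, q; t q^{k+1}))]⁻¹`. -/
noncomputable def leftFactor {L : Type*} [Field L] (x y u₁ u₂ u₃ u₄ α q : L) (k : ℕ) :
    PowerSeries L :=
  (1 - PowerSeries.X * PowerSeries.C (α * q ^ k * (1 - q)) *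
    (PowerSeries.C u₃ +
      PowerSeries.C u₂ * PowerSeries.rescale (q ^ (k + 1)) (F u₁ x y u₄ q)))⁻¹

/-- The second factor of `G_k`:
`[1 - (t β / q^k) (q - 1) (u₄ + u₂ F(x, y, u₃, 1/q; t / q^k))]⁻¹`. -/
noncomputable def rightFactor {L : Type*} [Field L] (x y u₁ u₂ u₃ u₄ β q : L) (k : ℕ) :
    PowerSeries L :=
  (1 - PowerSeries.X * PowerSeries.C (β / q ^ k * (q - 1)) *
    (PowerSeries.C u₄ +
      PowerSeries.C u₂ * PowerSeries.rescale (1 / q ^ k) (F u₁ x y u₃ (1 / q))))⁻¹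

/-! ### Infinite products -/

/-- `∏_{k ≥ 0} f k = g` for power series over a valued field: every coefficient of the partial
products converges, for the topology of the valuation `v`, to that of `g`. -/
def HasInfiniteProd {L : Type*} [Field L] (v : Valuation L ℤᵐ⁰) (f : ℕ → PowerSeries L)
    (g : PowerSeries L) : Prop :=
  ∀ n : ℕ, ∀ ε : ℤᵐ⁰, 0 < ε → ∀ᶠ N : ℕ in Filter.atTop,
    v (PowerSeries.coeff n (∏ k ∈ Finset.range N, f k) - PowerSeries.coeff n g) < ε

/-- The valuation of `K(q)` at `q = 0`, for which `|q| < 1`. -/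
noncomputable def valZero (K : Type*) [Field K] : Valuation (RatFunc K) ℤᵐ⁰ :=
  (Polynomial.idealX K).valuation (RatFunc K)

open scoped Classical in
/-- The valuation of `K(q)` at `q = ∞`, for which `|1/q| < 1`. -/
noncomputable def valInfty (K : Type*) [Field K] : Valuation (RatFunc K) ℤᵐ⁰ :=
  RatFunc.inftyValuation K

end StirlingEulerian

/-! Cut a word at its largest letter: `w = w₁ m w₂`. All the statistics split. The neighbours of a
letter inside `w₁` or `w₂` do not change if `m` is kept as a boundary value, left-to-right maxima
survive only in `w₁`, right-to-left maxima only in `w₂`, and `inv` gains the pairs between `w₁` and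
`w₂` together with the `|w₂|` pairs that involve `m`. For series in `t^n / [n]_q!`, the sum over the
letter sets of `w₁` and `w₂` is a product (`sum_powerset_qCoeff`), removing `m` is the
`q`-derivative `D`, and the factor `q^|w₂|` replaces `t` by `qt`.

Three series arise, according to whether the boundary values lie above or below the letters. With
both above, the nonempty words give `f` with `D f = u₁ + u₄ f(qt) + u₃ f + u₂ f f(qt)`; this Riccati
equation is linearised by `q`-exponentials, and its solution is `F` (`qDeriv_F`). With only the
right one above, the series `a` satisfies `D a = a α (u₃ + u₂ f(qt))`; with only the left one above,
`b` satisfies `D b = b(qt) β (u₄ + u₂ f)`. Cutting a permutation at its maximum gives the left-hand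
side as `a(t) b(qt)` (`qCoeff_mul_rescale_eq_P`).

Written as functional equations, the last two relations say that `a(qt)/a(t)` and `b(t)/b(qt)` are
explicit. Iterating `t ↦ qt` for `a(t)` and `t ↦ t/q` for `b(qt)` gives the two products
(`hasInfiniteProd_of_rescale`), once `F` at `(u₃, 1/q)` is identified with `F` at `(u₄, q)`
(`F_inv_eq`). Both limits have coefficients in `K(q)`, so the two different topologies do not
conflict. -/

namespace StirlingEulerian

/-! ### Words and their statistics -/

/-- The words in which each element of `S` occurs exactly once, and nothing else. -/
noncomputable def arrangements (S : Finset ℕ) : Finset (List ℕ) :=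
  ⟨S.val.lists, Multiset.lists_nodup_finset S⟩

theorem mem_arrangements {S : Finset ℕ} {w : List ℕ} :
    w ∈ arrangements S ↔ w.Nodup ∧ w.toFinset = S := by
  unfold arrangements
  rw [Finset.mem_mk, Multiset.mem_lists_iff]
  constructor
  · intro h
    have hn : w.Nodup := by
      have := S.nodup
      rw [h] at this
      simpa using this
    refine ⟨hn, ?_⟩
    ext a
    rw [List.mem_toFinset, ← Finset.mem_val, h]
    simp
  · rintro ⟨hn, rfl⟩
    rw [List.toFinset_val, hn.dedup]
    rfl

theorem arrangements_empty : arrangements ∅ = {[]} := by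
  ext w
  rw [mem_arrangements, Finset.mem_singleton]
  constructor
  · rintro ⟨-, h⟩
    simpa using h
  · rintro rfl
    simp

/-- Each word factors uniquely at its letter `m`; `T` is the set of letters to the left of `m`. -/
theorem sum_arrangements_insert {A : Type*} [AddCommMonoid A] {m : ℕ} {S : Finset ℕ}
    (hm : m ∉ S) (f : List ℕ → A) :
    ∑ w ∈ arrangements (insert m S), f w =
      ∑ T ∈ S.powerset, ∑ w₁ ∈ arrangements T, ∑ w₂ ∈ arrangements (S \ T),
        f (w₁ ++ m :: w₂) := by
  simp_rw [← Finset.sum_product', Finset.sum_sigma']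
  symm
  refine Finset.sum_bij (fun a _ => a.2.1 ++ m :: a.2.2) ?_ ?_ ?_ ?_
  · rintro ⟨T, w₁, w₂⟩ h
    simp only [Finset.mem_sigma, Finset.mem_powerset, Finset.mem_product, mem_arrangements] at h ⊢
    obtain ⟨hT, ⟨n₁, h₁⟩, n₂, h₂⟩ := h
    have e₁ : ∀ a, a ∈ w₁ ↔ a ∈ T := fun a => by rw [← h₁, List.mem_toFinset]
    have e₂ : ∀ a, a ∈ w₂ ↔ a ∈ S ∧ a ∉ T := fun a => by
      rw [← Finset.mem_sdiff, ← h₂, List.mem_toFinset]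
    constructor
    · rw [List.nodup_append, List.nodup_cons]
      refine ⟨n₁, ⟨fun h => hm ((e₂ m).1 h).1, n₂⟩, ?_⟩
      intro a ha b hb hab
      subst hab
      rcases List.mem_cons.1 hb with rfl | hb
      · exact hm (hT ((e₁ _).1 ha))
      · exact ((e₂ a).1 hb).2 ((e₁ a).1 ha)
    · ext a
      simp only [List.mem_toFinset, List.mem_append, List.mem_cons, e₁, e₂, Finset.mem_insert]
      have := @hT a
      tauto
  · rintro ⟨T, w₁, w₂⟩ h ⟨T', w₁', w₂'⟩ h' heq
    simp only [Finset.mem_sigma, Finset.mem_powerset, Finset.mem_product, mem_arrangements] at h h'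
    obtain ⟨hT, ⟨n₁, h₁⟩, n₂, h₂⟩ := h
    obtain ⟨hT', ⟨n₁', h₁'⟩, n₂', h₂'⟩ := h'
    have a₁ : m ∉ w₁' := fun h => hm (hT' (by rw [← h₁']; simpa using h))
    have a₂ : m ∉ w₁ := fun h => hm (hT (by rw [← h₁]; simpa using h))
    have a₃ : m ∉ w₂ := fun h => hm (by
      have : m ∈ S \ T := by rw [← h₂]; simpa using h
      exact (Finset.mem_sdiff.1 this).1)
    obtain ⟨rfl, -, rfl⟩ := (List.append_cons_inj_of_notMem a₂ a₃).1 heq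
    subst h₁ h₁'
    rfl
  · intro w hw
    rw [mem_arrangements] at hw
    obtain ⟨hn, hw⟩ := hw
    obtain ⟨w₁, w₂, rfl⟩ := List.append_of_mem (a := m) (l := w)
      (by rw [← List.mem_toFinset, hw]; simp)
    rw [List.nodup_append, List.nodup_cons] at hn
    obtain ⟨n₁, ⟨hm₂, n₂⟩, hd⟩ := hn
    have hm₁ : m ∉ w₁ := fun h => hd m h m (by simp) rfl
    have hS : ∀ a, a ∈ S ↔ a ∈ w₁ ∨ a ∈ w₂ := by
      intro a
      have := Finset.ext_iff.1 hw a
      simp only [List.mem_toFinset, List.mem_append, List.mem_cons, Finset.mem_insert] at this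
      by_cases ham : a = m
      · subst ham; tauto
      · tauto
    refine ⟨⟨w₁.toFinset, w₁, w₂⟩, ?_, rfl⟩
    simp only [Finset.mem_sigma, Finset.mem_powerset, Finset.mem_product, mem_arrangements]
    refine ⟨fun a ha => (hS a).2 (Or.inl (by simpa using ha)), ⟨n₁, trivial⟩, n₂, ?_⟩
    ext a
    simp only [List.mem_toFinset, Finset.mem_sdiff, hS]
    have : a ∈ w₁ → a ∉ w₂ := fun h₁ h₂ => hd a h₁ a (by simp [h₂]) rfl
    tauto
  · intros; rfl

/-- The number of letters of `w` that form, with their two neighbours in the word `p w r`,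
a triple satisfying `Q`. -/
def tripleCount (Q : ℕ → ℕ → ℕ → Prop) [∀ a b c, Decidable (Q a b c)] :
    ℕ → List ℕ → ℕ → ℕ
  | _, [], _ => 0
  | p, c :: w, r => (if Q p c (w.headD r) then 1 else 0) + tripleCount Q c w r

theorem tripleCount_append (Q : ℕ → ℕ → ℕ → Prop) [∀ a b c, Decidable (Q a b c)]
    (p m r : ℕ) (w₁ w₂ : List ℕ) :
    tripleCount Q p (w₁ ++ m :: w₂) r =
      tripleCount Q p w₁ m + (if Q (w₁.getLastD p) m (w₂.headD r) then 1 else 0) +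
        tripleCount Q m w₂ r := by
  induction w₁ generalizing p with
  | nil => simp [tripleCount]
  | cons c w ih =>
    have h1 : (w ++ m :: w₂).headD r = w.headD m := by cases w <;> rfl
    rw [List.cons_append, tripleCount, tripleCount, ih, h1]
    simp only [List.getLastD_cons]
    ring

theorem tripleCount_eq_sum (Q : ℕ → ℕ → ℕ → Prop) [∀ a b c, Decidable (Q a b c)]
    (p r : ℕ) (w : List ℕ) :
    tripleCount Q p w r = ∑ i ∈ Finset.range w.length,
      if Q ((p :: w ++ [r]).getD i 0) ((p :: w ++ [r]).getD (i + 1) 0)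
        ((p :: w ++ [r]).getD (i + 2) 0) then 1 else 0 := by
  induction w generalizing p with
  | nil => simp [tripleCount]
  | cons c w ih =>
    have h1 : ((w ++ [r]).getD 0 0) = w.headD r := by cases w <;> rfl
    rw [tripleCount, ih, List.length_cons, Finset.sum_range_succ', add_comm]
    congr 1
    simp only [List.cons_append, List.getD_cons_zero, List.getD_cons_succ, zero_add, h1]

/-- The number of right-to-left maxima of a word. -/
def rightMaxima : List ℕ → ℕ
  | [] => 0
  | c :: w => (if ∀ x ∈ w, x < c then 1 else 0) + rightMaxima w

theorem rightMaxima_append {m : ℕ} {w₁ w₂ : List ℕ} (h₁ : ∀ x ∈ w₁, x < m)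
    (h₂ : ∀ x ∈ w₂, x < m) : rightMaxima (w₁ ++ m :: w₂) = rightMaxima w₂ + 1 := by
  induction w₁ with
  | nil =>
    rw [List.nil_append, rightMaxima, if_pos h₂, add_comm]
  | cons c w ih =>
    have hc := h₁ c (by simp)
    rw [List.cons_append, rightMaxima, if_neg, ih fun x hx => h₁ x (by simp [hx]), zero_add]
    intro h
    exact absurd (h m (by simp)) (by omega)

/-- The number of left-to-right maxima of a word. -/
def leftMaxima (w : List ℕ) : ℕ := rightMaxima w.reverse

theorem leftMaxima_append {m : ℕ} {w₁ w₂ : List ℕ} (h₁ : ∀ x ∈ w₁, x < m)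
    (h₂ : ∀ x ∈ w₂, x < m) : leftMaxima (w₁ ++ m :: w₂) = leftMaxima w₁ + 1 := by
  unfold leftMaxima
  rw [List.reverse_append, List.reverse_cons, List.append_assoc, List.singleton_append,
    rightMaxima_append] <;> simpa

/-- The number of inversions of a word. -/
def inversions : List ℕ → ℕ
  | [] => 0
  | c :: w => w.countP (· < c) + inversions w

/-- The number of pairs in `T × U` whose first entry is the larger one. -/
def crossInversions (T U : Finset ℕ) : ℕ := ∑ a ∈ T, (U.filter (· < a)).card

theorem countP_lt_eq_card {w : List ℕ} (hw : w.Nodup) (a : ℕ) :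
    w.countP (· < a) = (w.toFinset.filter (· < a)).card := by
  rw [List.countP_eq_length_filter, ← List.toFinset_card_of_nodup (hw.filter _),
    List.toFinset_filter]
  simp

theorem inversions_append {m : ℕ} {w₁ w₂ : List ℕ} (h₁ : ∀ x ∈ w₁, x < m)
    (h₂ : ∀ x ∈ w₂, x < m) (n₁ : w₁.Nodup) (n₂ : w₂.Nodup) :
    inversions (w₁ ++ m :: w₂) = inversions w₁ + inversions w₂ +
      (crossInversions w₁.toFinset w₂.toFinset + w₂.toFinset.card) := by
  induction w₁ with
  | nil =>
    have : w₂.countP (· < m) = w₂.length := by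
      rw [List.countP_eq_length]; simpa using h₂
    rw [List.nil_append]
    simp only [inversions, this, List.toFinset_card_of_nodup n₂, crossInversions, List.toFinset_nil,
      Finset.sum_empty]
    ring
  | cons c w ih =>
    have hc := h₁ c (by simp)
    rw [List.nodup_cons] at n₁
    rw [List.cons_append, inversions, ih (fun x hx => h₁ x (by simp [hx])) n₁.2, inversions,
      List.countP_append, List.countP_cons, countP_lt_eq_card n₂, List.toFinset_cons]
    have : crossInversions (insert c w.toFinset) w₂.toFinset =
        (w₂.toFinset.filter (· < c)).card + crossInversions w.toFinset w₂.toFinset :=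
      Finset.sum_insert (by simpa using n₁.1)
    rw [this, if_neg (by simpa using hc.le)]
    ring

/-! ### Words attached to permutations -/

/-- The one-line notation `σ₁ ⋯ σₙ`. -/
def word {n : ℕ} (σ : Equiv.Perm (Fin n)) : List ℕ := List.ofFn fun i => (σ i : ℕ) + 1

theorem sum_perm_eq_sum_arrangements {A : Type*} [AddCommMonoid A] (n : ℕ) (f : List ℕ → A) :
    ∑ σ : Equiv.Perm (Fin n), f (word σ) = ∑ w ∈ arrangements (Finset.Icc 1 n), f w := by
  refine Finset.sum_bij (fun σ _ => word σ) ?_ ?_ ?_ ?_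
  · intro σ _
    rw [mem_arrangements]
    refine ⟨?_, ?_⟩
    · rw [word, List.nodup_ofFn]
      intro a b h
      exact σ.injective (Fin.ext (by simpa using h))
    · ext a
      rw [List.mem_toFinset, word, List.mem_ofFn', Finset.mem_Icc]
      constructor
      · rintro ⟨i, rfl⟩
        exact ⟨by simp, (σ i).2⟩
      · rintro ⟨h1, h2⟩
        refine ⟨σ.symm ⟨a - 1, by omega⟩, ?_⟩
        simp
        omega
  · intro σ _ τ _ h
    have := List.ofFn_injective h
    ext i
    simpa using congrFun this i
  · intro w hw
    rw [mem_arrangements] at hw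
    obtain ⟨hn, hw⟩ := hw
    have hl : w.length = n := by
      rw [← List.toFinset_card_of_nodup hn, hw]; simp
    subst hl
    have hmem : ∀ i : Fin w.length, 1 ≤ w.get i ∧ w.get i ≤ w.length := by
      intro i
      rw [← Finset.mem_Icc, ← hw, List.mem_toFinset]
      exact List.get_mem w i
    have hinj : Function.Injective
        (fun i : Fin w.length => (⟨w.get i - 1, by have := hmem i; omega⟩ : Fin w.length)) := by
      intro i j h
      have h' : w.get i - 1 = w.get j - 1 := congrArg Fin.val h
      exact List.nodup_iff_injective_get.1 hn (by have := hmem i; have := hmem j; omega)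
    refine ⟨Equiv.ofBijective _ (Finite.injective_iff_bijective.1 hinj), Finset.mem_univ _, ?_⟩
    rw [word]
    conv_rhs => rw [← List.ofFn_get w]
    congr 1
    funext i
    have := hmem i
    rw [Equiv.ofBijective_apply]
    show w.get i - 1 + 1 = w.get i
    omega
  · intros; rfl

theorem getD_word {n : ℕ} (σ : Equiv.Perm (Fin n)) (i : ℕ) :
    (0 :: word σ ++ [0]).getD i 0 = letter σ i := by
  unfold letter
  rcases i with _ | i
  · simp
  · rw [List.cons_append, List.getD_cons_succ]
    by_cases h : i < n
    · rw [dif_pos ⟨by omega, by omega⟩, List.getD_append _ _ _ _ (by simpa [word] using h),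
        List.getD_eq_getElem _ _ (by simpa [word] using h)]
      simp [word]
    · rw [dif_neg (by omega), List.getD_append_right _ _ _ _ (by simpa [word] using h)]
      -- The index meets either the final boundary letter or the default of `getD`; both are 0, as
      -- `letter` requires out of range.
      rcases i - (word σ).length with _ | j <;> simp

theorem tripleCount_word (Q : ℕ → ℕ → ℕ → Prop) [∀ a b c, Decidable (Q a b c)]
    {n : ℕ} (σ : Equiv.Perm (Fin n)) :
    tripleCount Q 0 (word σ) 0 =
      ((Finset.Icc 1 n).filter fun i => Q (letter σ (i - 1)) (letter σ i) (letter σ (i + 1))).card := by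
  rw [tripleCount_eq_sum, Finset.card_filter]
  simp_rw [getD_word]
  have hl : (word σ).length = n := by simp [word]
  rw [hl, Finset.range_eq_Ico, ← Finset.Ico_add_one_right_eq_Icc,
    ← Finset.sum_Ico_add' (fun i => if Q (letter σ (i - 1)) (letter σ i) (letter σ (i + 1))
      then 1 else 0) 0 n 1]
  rfl

theorem rightMaxima_ofFn {n : ℕ} (g : Fin n → ℕ) :
    rightMaxima (List.ofFn g) =
      (Finset.univ.filter fun i : Fin n => ∀ j : Fin n, i < j → g j < g i).card := by
  induction n with
  | zero => simp [rightMaxima]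
  | succ n ih =>
    rw [List.ofFn_succ, rightMaxima, ih, Finset.card_filter, Finset.card_filter, Fin.sum_univ_succ]
    simp only [Fin.forall_fin_succ, List.forall_mem_ofFn_iff, Fin.succ_lt_succ_iff, Fin.succ_pos,
      forall_const, lt_irrefl, Fin.not_lt_zero, false_imp_iff, true_and]

theorem rightMaxima_word {n : ℕ} (σ : Equiv.Perm (Fin n)) : rightMaxima (word σ) = rma σ := by
  rw [word, rightMaxima_ofFn, rma]
  simp

theorem leftMaxima_word {n : ℕ} (σ : Equiv.Perm (Fin n)) : leftMaxima (word σ) = lma σ := by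
  have : (word σ).reverse = List.ofFn fun i : Fin n => ((σ (Fin.rev i) : ℕ) + 1) := by
    refine List.ext_getElem (by simp [word]) fun i h₁ h₂ => ?_
    simp only [word, List.getElem_reverse, List.getElem_ofFn, List.length_ofFn]
    congr 3
    ext
    simp only [Fin.val_rev]
    omega
  rw [leftMaxima, this, rightMaxima_ofFn, lma]
  refine Finset.card_bij (fun i _ => Fin.rev i) ?_ ?_ ?_
  · intro i hi
    simp only [Finset.mem_filter, Finset.mem_univ, true_and] at hi ⊢
    intro j hj
    have := hi (Fin.rev j) (by rw [← Fin.rev_lt_rev, Fin.rev_rev]; exact hj)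
    rw [Fin.rev_rev] at this
    exact Fin.lt_def.2 (by omega)
  · intro i _ j _ h
    exact Fin.rev_injective h
  · intro i hi
    simp only [Finset.mem_filter, Finset.mem_univ, true_and] at hi
    refine ⟨Fin.rev i, ?_, Fin.rev_rev i⟩
    simp only [Finset.mem_filter, Finset.mem_univ, true_and]
    intro j hj
    rw [Fin.rev_rev]
    have := Fin.lt_def.1 (hi (Fin.rev j) (by rw [← Fin.rev_lt_rev, Fin.rev_rev]; exact hj))
    omega

theorem countP_ofFn {n : ℕ} (p : ℕ → Bool) (g : Fin n → ℕ) :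
    (List.ofFn g).countP p = ∑ i : Fin n, if p (g i) then 1 else 0 := by
  induction n with
  | zero => simp
  | succ n ih => rw [List.ofFn_succ, List.countP_cons, ih, Fin.sum_univ_succ, add_comm]

theorem inversions_ofFn {n : ℕ} (g : Fin n → ℕ) :
    inversions (List.ofFn g) =
      ∑ i : Fin n, ∑ j : Fin n, if i < j ∧ g i > g j then 1 else 0 := by
  induction n with
  | zero => simp [inversions]
  | succ n ih =>
    rw [List.ofFn_succ, inversions, ih, countP_ofFn, Fin.sum_univ_succ]
    simp only [Fin.sum_univ_succ, lt_irrefl, false_and, if_false, zero_add, Fin.succ_pos, true_and,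
      Fin.succ_lt_succ_iff, Fin.not_lt_zero, decide_eq_true_eq, gt_iff_lt]

theorem inversions_word {n : ℕ} (σ : Equiv.Perm (Fin n)) : inversions (word σ) = inv σ := by
  rw [word, inversions_ofFn, inv, Finset.card_filter, ← Finset.univ_product_univ,
    Finset.sum_product]
  simp

/-! ### The `q`-derivative -/

section QDerivative

open PowerSeries

variable {L : Type*} [Field L]

/-- The `q`-derivative `(f(qt) - f(t)) / ((q - 1) t)`, defined for every `q`. -/
noncomputable def qDeriv (q : L) (f : PowerSeries L) : PowerSeries L :=
  mk fun n => (∑ j ∈ Finset.range (n + 1), q ^ j) * coeff (n + 1) f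

/-- The coefficient of `t ^ n / [n]_q!` in `f`. -/
noncomputable def qCoeff (q : L) (n : ℕ) (f : PowerSeries L) : L := qFactorial q n * coeff n f

theorem qFactorial_zero (q : L) : qFactorial q 0 = 1 := by simp [qFactorial]

theorem qFactorial_succ (q : L) (n : ℕ) :
    qFactorial q (n + 1) = qFactorial q n * ∑ j ∈ Finset.range (n + 1), q ^ j := by
  unfold qFactorial
  rw [Finset.prod_Icc_succ_top (by omega)]

theorem qFactorial_ne_zero {q : L} (hq : ∀ n, ∑ j ∈ Finset.range (n + 1), q ^ j ≠ 0) (n : ℕ) :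
    qFactorial q n ≠ 0 := by
  induction n with
  | zero => simp [qFactorial_zero]
  | succ n ih => rw [qFactorial_succ]; exact mul_ne_zero ih (hq n)

theorem qCoeff_zero (q : L) (f : PowerSeries L) : qCoeff q 0 f = constantCoeff f := by
  simp [qCoeff, qFactorial_zero]

theorem qCoeff_succ (q : L) (n : ℕ) (f : PowerSeries L) :
    qCoeff q (n + 1) f = qCoeff q n (qDeriv q f) := by
  rw [qCoeff, qCoeff, qFactorial_succ, qDeriv, coeff_mk, mul_assoc]

theorem qCoeff_add (q : L) (n : ℕ) (f g : PowerSeries L) :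
    qCoeff q n (f + g) = qCoeff q n f + qCoeff q n g := by
  simp [qCoeff, mul_add]

theorem qCoeff_C_mul (q : L) (n : ℕ) (c : L) (f : PowerSeries L) :
    qCoeff q n (C c * f) = c * qCoeff q n f := by
  rw [qCoeff, qCoeff, coeff_C_mul]; ring

theorem qCoeff_one (q : L) (n : ℕ) : qCoeff q n 1 = if n = 0 then 1 else 0 := by
  rw [qCoeff, coeff_one]
  split_ifs with h
  · simp [h, qFactorial_zero]
  · simp

theorem qCoeff_rescale (q c : L) (n : ℕ) (f : PowerSeries L) :
    qCoeff q n (rescale c f) = c ^ n * qCoeff q n f := by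
  rw [qCoeff, qCoeff, coeff_rescale]; ring

theorem rescale_C (c a : L) : rescale c (C a) = C a := by
  ext n
  rw [coeff_rescale, coeff_C]
  split_ifs with h <;> simp [h]

theorem constantCoeff_rescale (c : L) (f : PowerSeries L) :
    constantCoeff (rescale c f) = constantCoeff f := by
  rw [← coeff_zero_eq_constantCoeff_apply, coeff_rescale]
  simp

theorem X_mul_qDeriv (q : L) (f : PowerSeries L) :
    C (q - 1) * X * qDeriv q f = rescale q f - f := by
  ext n
  rw [mul_assoc, coeff_C_mul, map_sub, coeff_rescale]
  rcases n with _ | n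
  · simp
  · rw [coeff_succ_X_mul, qDeriv, coeff_mk, ← mul_assoc, mul_geom_sum]
    ring

/-- This trades `q`-differential equations for functional equations between `f(qt)` and `f(t)`,
which can be rescaled and iterated. -/
theorem eq_qDeriv_iff {q : L} (hq : q ≠ 1) {f g : PowerSeries L} :
    qDeriv q f = g ↔ rescale q f - f = C (q - 1) * X * g := by
  rw [← X_mul_qDeriv]
  have : (C (q - 1) * X : PowerSeries L) ≠ 0 :=
    mul_ne_zero
      (fun h => sub_ne_zero.2 hq (by simpa using congrArg constantCoeff h)) X_ne_zero
  exact (mul_right_inj' this).symm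

theorem qDeriv_mul {q : L} (hq : q ≠ 1) (f g : PowerSeries L) :
    qDeriv q (f * g) = f * qDeriv q g + qDeriv q f * rescale q g := by
  rw [eq_qDeriv_iff hq, map_mul]
  linear_combination (-f) * X_mul_qDeriv q g - rescale q g * X_mul_qDeriv q f

/-! ### The `q`-binomial theorem over subsets -/

theorem crossInversions_insert_right {T U : Finset ℕ} {m : ℕ} (hT : ∀ x ∈ T, x < m) :
    crossInversions T (insert m U) = crossInversions T U := by
  refine Finset.sum_congr rfl fun a ha => ?_
  rw [Finset.filter_insert, if_neg (by have := hT a ha; omega)]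

theorem crossInversions_insert_left {T U : Finset ℕ} {m : ℕ} (hm : m ∉ T)
    (hU : ∀ x ∈ U, x < m) :
    crossInversions (insert m T) U = U.card + crossInversions T U := by
  rw [crossInversions, Finset.sum_insert hm, Finset.filter_true_of_mem hU, crossInversions]

/-- The `q`-binomial theorem for products of `q`-exponential generating functions. -/
theorem sum_powerset_qCoeff {q : L} (hq : q ≠ 1) (S : Finset ℕ) (f g : PowerSeries L) :
    ∑ T ∈ S.powerset, q ^ crossInversions T (S \ T) *
        (qCoeff q T.card f * qCoeff q (S \ T).card g) =
      qCoeff q S.card (f * g) := by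
  induction S using Finset.induction_on_max generalizing f g with
  | empty => simp [qCoeff_zero, crossInversions]
  | insert m S hS ih =>
    have hm : m ∉ S := fun h => lt_irrefl _ (hS m h)
    -- The two terms of the `q`-Leibniz rule are the cases `m ∉ T` and `m ∈ T`. On the right, the
    -- maximum `m` makes no cross inversion; on the left, it makes `|S \ T|` of them, whence
    -- `g(qt)`.
    rw [Finset.sum_powerset_insert hm, Finset.card_insert_of_notMem hm, qCoeff_succ,
      qDeriv_mul hq, qCoeff_add, ← ih, ← ih]
    congr 1
    · refine Finset.sum_congr rfl fun T hT => ?_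
      rw [Finset.mem_powerset] at hT
      rw [Finset.insert_sdiff_of_notMem _ fun h => hm (hT h),
        Finset.card_insert_of_notMem (by simp [hm]), qCoeff_succ,
        crossInversions_insert_right fun x hx => hS x (hT hx)]
    · refine Finset.sum_congr rfl fun T hT => ?_
      rw [Finset.mem_powerset] at hT
      have : insert m S \ insert m T = S \ T := by
        ext a
        simp only [Finset.mem_sdiff, Finset.mem_insert]
        by_cases h : a = m
        · subst h; tauto
        · tauto
      rw [this, Finset.card_insert_of_notMem fun h => hm (hT h), qCoeff_succ,
        crossInversions_insert_left (fun h => hm (hT h))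
          (fun x hx => hS x (Finset.mem_sdiff.1 hx).1), qCoeff_rescale, pow_add]
      ring

/-! ### Linear `q`-difference equations -/

/-- The solution of `a 0 = 1`, `a (n + 1) = ∑ i ≤ n, c n i * a i`. -/
def recSolution (c : ℕ → ℕ → L) : ℕ → L
  | 0 => 1
  | n + 1 => ∑ i : Fin (n + 1), c n i.1 * recSolution c i.1

/-- Comparing coefficients gives a recursion that can be solved because `[n+1]_q ≠ 0`. The case `c =
1` supplies `a`, the case `c = q` supplies `b`. -/
theorem exists_qDeriv_eq {q : L} (hq : ∀ n, ∑ j ∈ Finset.range (n + 1), q ^ j ≠ 0) (c : L)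
    (g : PowerSeries L) :
    ∃ a : PowerSeries L, constantCoeff a = 1 ∧ qDeriv q a = rescale c a * g := by
  refine ⟨mk (recSolution fun n i : ℕ =>
    c ^ i * coeff (n - i) g / (∑ j ∈ Finset.range (n + 1), q ^ j)), ?_, ?_⟩
  · rw [← coeff_zero_eq_constantCoeff_apply, coeff_mk, recSolution]
  · ext n
    rw [coeff_mul, Finset.Nat.sum_antidiagonal_eq_sum_range_succ_mk, Finset.sum_range, qDeriv,
      coeff_mk, coeff_mk, recSolution, Finset.mul_sum]
    refine Finset.sum_congr rfl fun i _ => ?_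
    rw [coeff_rescale, coeff_mk]
    have := hq n
    field_simp

/-! ### The Pan–Zeng series -/

theorem qDeriv_qExp {q : L} (hq : ∀ n, ∑ j ∈ Finset.range (n + 1), q ^ j ≠ 0) (c : L) :
    qDeriv q (qExp q c) = C c * qExp q c := by
  ext n
  rw [qDeriv, coeff_mk, coeff_C_mul, qExp, coeff_mk, coeff_mk, qFactorial_succ]
  have h1 := hq n
  have h2 := qFactorial_ne_zero hq n
  field_simp
  ring

theorem constantCoeff_qExp (q c : L) : constantCoeff (qExp q c) = 1 := by
  rw [← coeff_zero_eq_constantCoeff_apply, qExp, coeff_mk]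
  simp [qFactorial_zero]

theorem constantCoeff_F (u₁ x y u q : L) : constantCoeff (F u₁ x y u q) = 0 := by
  simp [F, constantCoeff_qExp]

/-- `F` is a quotient of combinations of two solutions of linear first-order `q`-equations, as for a
classical Riccati equation; `x` and `y` are the roots of `z² - (u₃ + u₄) z + u₁ u₂`. -/
theorem qDeriv_F {q : L} (hq1 : q ≠ 1) (hq : ∀ n, ∑ j ∈ Finset.range (n + 1), q ^ j ≠ 0)
    {x y u₁ u₂ u₃ u₄ : L} (hxy : x ≠ y) (hsum : x + y = u₃ + u₄) (hprod : x * y = u₁ * u₂) :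
    qDeriv q (F u₁ x y u₄ q) = C u₁ + C u₄ * rescale q (F u₁ x y u₄ q) + C u₃ * F u₁ x y u₄ q +
      C u₂ * (F u₁ x y u₄ q * rescale q (F u₁ x y u₄ q)) := by
  have e₁ := (eq_qDeriv_iff hq1).1 (qDeriv_qExp hq (x - u₄))
  have e₂ := (eq_qDeriv_iff hq1).1 (qDeriv_qExp hq (y - u₄))
  set E₁ := qExp q (x - u₄) with hE₁
  set E₂ := qExp q (y - u₄) with hE₂
  have hd : constantCoeff (C x * E₂ - C y * E₁) ≠ 0 := by
    simpa [hE₁, hE₂, constantCoeff_qExp] using sub_ne_zero.2 hxy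
  have hf : F u₁ x y u₄ q * (C x * E₂ - C y * E₁) = C u₁ * (E₁ - E₂) := by
    rw [F, mul_assoc, PowerSeries.inv_mul_cancel _ hd, mul_one]
  have hfq := congrArg (rescale q) hf
  simp only [map_mul, map_sub, rescale_C] at hfq
  have hd0 : C x * E₂ - C y * E₁ ≠ 0 := fun h => hd (by rw [h, map_zero])
  have hdq0 : C x * rescale q E₂ - C y * rescale q E₁ ≠ 0 := fun h => hd (by
    have h' : constantCoeff (C x * rescale q E₂ - C y * rescale q E₁) = 0 := by rw [h, map_zero]
    simpa only [map_sub, map_mul, constantCoeff_rescale] using h')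
  have hsum' : (C u₃ : PowerSeries L) = C x + C y - C u₄ := by
    rw [← map_add, hsum, map_add]; ring
  have hprod' : (C u₁ * C u₂ : PowerSeries L) = C x * C y := by
    rw [← map_mul, ← hprod, map_mul]
  rw [eq_qDeriv_iff hq1]
  -- Clearing the denominators of `f(t)` and `f(qt)` leaves the polynomial identity `key` in `E₁`,
  -- `E₂`, since `e₁'` and `e₂'` eliminate the rescaled exponentials.
  refine mul_right_cancel₀ (mul_ne_zero hd0 hdq0) ?_
  set f := F u₁ x y u₄ q
  set fq := rescale q f
  have e₁' : rescale q E₁ = E₁ + C (q - 1) * X * ((C x - C u₄) * E₁) := by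
    rw [← map_sub, ← e₁]; ring
  have e₂' : rescale q E₂ = E₂ + C (q - 1) * X * ((C y - C u₄) * E₂) := by
    rw [← map_sub, ← e₂]; ring
  set D := C x * E₂ - C y * E₁ with hD
  set Dq := C x * rescale q E₂ - C y * rescale q E₁ with hDq
  set N := C u₁ * (E₁ - E₂) with hN
  set Nq := C u₁ * (rescale q E₁ - rescale q E₂) with hNq
  generalize C (q - 1) * X = s at *
  have key : Nq * D - N * Dq =
      s * (C u₁ * (D * Dq) + C u₄ * (Nq * D) + C u₃ * (N * Dq) + C u₂ * (N * Nq)) := by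
    have h2 : C u₂ * (N * Nq) =
        C u₁ * ((C x * C y) * ((E₁ - E₂) * (rescale q E₁ - rescale q E₂))) := by
      rw [hN, hNq, ← hprod']; ring
    rw [h2, hsum', hN, hNq, hD, hDq, e₁', e₂']
    ring
  linear_combination key + (D - s * C u₄ * D - s * C u₂ * f * D) * hfq -
    (Dq + s * C u₃ * Dq + s * C u₂ * Nq) * hf

/-! ### Infinite products -/

/-- The partial products telescope to `a(t) / a(p^N t)`, and `a(p^N t)` tends to 1 coefficientwise.
-/
theorem hasInfiniteProd_of_rescale (v : Valuation L ℤᵐ⁰) {p : L} (hp : v p < 1)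
    {a : PowerSeries L} (ha : constantCoeff a = 1) {f : ℕ → PowerSeries L}
    (hf : ∀ k, f k * rescale (p ^ (k + 1)) a = rescale (p ^ k) a) : HasInfiniteProd v f a := by
  have hprod : ∀ N, (∏ k ∈ Finset.range N, f k) * rescale (p ^ N) a = a := by
    intro N
    induction N with
    | zero => simp
    | succ N ih => rw [Finset.prod_range_succ, mul_assoc, hf, ih]
  have hinv : a * a⁻¹ = 1 := PowerSeries.mul_inv_cancel _ (by rw [ha]; exact one_ne_zero)
  have hprod' : ∀ N, ∏ k ∈ Finset.range N, f k = a * rescale (p ^ N) a⁻¹ := by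
    intro N
    calc _ = (∏ k ∈ Finset.range N, f k) * rescale (p ^ N) (a * a⁻¹) := by
          rw [hinv, map_one, mul_one]
      _ = _ := by rw [map_mul, ← mul_assoc, hprod]
  have hinv0 : coeff 0 a⁻¹ = 1 := by simp [ha]
  have hsmall : ∀ (c : L) (ε : ℤᵐ⁰), 0 < ε → ∃ N₀, ∀ N ≥ N₀, v (p ^ N * c) < ε := by
    intro c ε hε
    rcases eq_or_ne c 0 with rfl | hc
    · exact ⟨0, fun N _ => by simpa using hε⟩
    have hvc : 0 < v c := zero_lt_iff.2 ((Valuation.ne_zero_iff v).2 hc)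
    obtain ⟨N₀, h₀⟩ := exists_pow_lt₀ hp (Units.mk0 (ε / v c) (div_pos hε hvc).ne')
    refine ⟨N₀, fun N hN => ?_⟩
    rw [map_mul, map_pow]
    rw [Units.val_mk0, lt_div_iff₀ hvc] at h₀
    exact lt_of_le_of_lt (mul_le_mul_left (pow_le_pow_right_of_le_one' hp.le hN) _) h₀
  intro n ε hε
  choose N₀ hN₀ using fun c : L => hsmall c ε hε
  rw [Filter.eventually_atTop]
  -- The sum dominates the thresholds of all error terms `i < n`; the term `i = n` is the limit
  -- itself.
  refine ⟨∑ i ∈ Finset.range n, N₀ (coeff i a * coeff (n - i) a⁻¹), fun N hN => ?_⟩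
  rw [hprod', coeff_mul, Finset.Nat.sum_antidiagonal_eq_sum_range_succ_mk, Finset.sum_range_succ]
  simp only [Nat.sub_self, coeff_rescale, hinv0, pow_zero, mul_one, add_sub_cancel_right]
  refine Valuation.map_sum_lt v hε.ne' fun i hi => ?_
  have hin := Finset.mem_range.1 hi
  have hN₁ : N₀ (coeff i a * coeff (n - i) a⁻¹) ≤ N * (n - i) :=
    ((Finset.single_le_sum (f := fun i => N₀ (coeff i a * coeff (n - i) a⁻¹))
      (fun _ _ => Nat.zero_le _) hi).trans hN).trans (Nat.le_mul_of_pos_right _ (by omega))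
  have := hN₀ _ _ hN₁
  rwa [pow_mul, ← mul_assoc, mul_comm _ (coeff i a), mul_assoc] at this

end QDerivative

/-! ### Weighted sums over words -/

/-- The middle letter of the triple is a valley. -/
abbrev IsValley (a b c : ℕ) : Prop := a > b ∧ b < c

/-- The middle letter of the triple is a peak. -/
abbrev IsPeak (a b c : ℕ) : Prop := a < b ∧ b > c

/-- The middle letter of the triple is a double ascent. -/
abbrev IsDoubleAscent (a b c : ℕ) : Prop := a < b ∧ b < c

/-- The middle letter of the triple is a double descent. -/
abbrev IsDoubleDescent (a b c : ℕ) : Prop := a > b ∧ b > c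

section Weights

variable {A : Type*} [CommRing A]

/-- The weight of a word `w`, its extreme letters having the neighbours `p` and `r`. -/
def wordWeight (u₁ u₂ u₃ u₄ α β q : A) (p : ℕ) (w : List ℕ) (r : ℕ) : A :=
  u₁ ^ tripleCount IsValley p w r * u₂ ^ tripleCount IsPeak p w r *
    u₃ ^ tripleCount IsDoubleAscent p w r * u₄ ^ tripleCount IsDoubleDescent p w r *
    α ^ leftMaxima w * β ^ rightMaxima w * q ^ inversions w

/-- The sum of the weights of the arrangements of `S`. -/
noncomputable def weightSum (u₁ u₂ u₃ u₄ α β q : A) (p : ℕ) (S : Finset ℕ) (r : ℕ) : A :=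
  ∑ w ∈ arrangements S, wordWeight u₁ u₂ u₃ u₄ α β q p w r

/-- The weight of a single letter, depending on whether it is larger than its neighbours. -/
def letterWeight (u₁ u₂ u₃ u₄ : A) (l r : Prop) [Decidable l] [Decidable r] : A :=
  if l then if r then u₂ else u₃ else if r then u₄ else u₁

/-- The parameter `β` disappears from the left part and `α` from the right part, because `m` hides
those maxima. The conditions `hp` and `hr` exclude ties, so `m` has exactly one of the four types.
-/
theorem wordWeight_append (u₁ u₂ u₃ u₄ α β q : A) {p m r : ℕ} {w₁ w₂ : List ℕ}
    (h₁ : ∀ x ∈ w₁, x < m) (h₂ : ∀ x ∈ w₂, x < m) (n₁ : w₁.Nodup) (n₂ : w₂.Nodup)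
    (hp : w₁.getLastD p ≠ m) (hr : w₂.headD r ≠ m) :
    wordWeight u₁ u₂ u₃ u₄ α β q p (w₁ ++ m :: w₂) r =
      q ^ crossInversions w₁.toFinset w₂.toFinset *
        (α * β * letterWeight u₁ u₂ u₃ u₄ (w₁.getLastD p < m) (w₂.headD r < m) *
          q ^ w₂.toFinset.card *
          (wordWeight u₁ u₂ u₃ u₄ α 1 q p w₁ m * wordWeight u₁ u₂ u₃ u₄ 1 β q m w₂ r)) := by
  simp only [wordWeight, tripleCount_append, leftMaxima_append h₁ h₂, rightMaxima_append h₁ h₂,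
    inversions_append h₁ h₂ n₁ n₂, letterWeight]
  generalize w₁.getLastD p = a at *
  generalize w₂.headD r = c at *
  rcases lt_or_gt_of_ne hp with ha | ha <;> rcases lt_or_gt_of_ne hr with hc | hc <;>
    simp only [IsValley, IsPeak, IsDoubleAscent, IsDoubleDescent, ha, hc, ha.not_gt, hc.not_gt,
      and_true, and_false, if_true, if_false, pow_add, one_pow] <;> ring

theorem getLastD_lt_iff {p m : ℕ} {w : List ℕ} (h : ∀ x ∈ w, x < m) :
    w.getLastD p < m ↔ w.toFinset.Nonempty ∨ p < m := by
  rcases w.eq_nil_or_concat with rfl | ⟨v, c, rfl⟩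
  · simp
  · simpa using h c (by simp)

theorem headD_lt_iff {r m : ℕ} {w : List ℕ} (h : ∀ x ∈ w, x < m) :
    w.headD r < m ↔ w.toFinset.Nonempty ∨ r < m := by
  cases w with
  | nil => simp
  | cons c w => simpa using h c (by simp)

theorem getLastD_ne {p m : ℕ} {w : List ℕ} (h : ∀ x ∈ w, x < m) (hp : p ≠ m) :
    w.getLastD p ≠ m := by
  rcases w.eq_nil_or_concat with rfl | ⟨v, c, rfl⟩
  · simpa
  · simpa using (h c (by simp)).ne

theorem headD_ne {r m : ℕ} {w : List ℕ} (h : ∀ x ∈ w, x < m) (hr : r ≠ m) :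
    w.headD r ≠ m := by
  cases w with
  | nil => simpa
  | cons c w => simpa using (h c (by simp)).ne

theorem weightSum_insert (u₁ u₂ u₃ u₄ α β q : A) {p m r : ℕ} {S : Finset ℕ}
    (hS : ∀ x ∈ S, x < m) (hp : p ≠ m) (hr : r ≠ m) :
    weightSum u₁ u₂ u₃ u₄ α β q p (insert m S) r =
      ∑ T ∈ S.powerset, q ^ crossInversions T (S \ T) *
        (α * β * letterWeight u₁ u₂ u₃ u₄ (T.Nonempty ∨ p < m) ((S \ T).Nonempty ∨ r < m) *
          q ^ (S \ T).card *
          (weightSum u₁ u₂ u₃ u₄ α 1 q p T m * weightSum u₁ u₂ u₃ u₄ 1 β q m (S \ T) r)) := by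
  rw [weightSum, sum_arrangements_insert fun h => lt_irrefl _ (hS m h)]
  refine Finset.sum_congr rfl fun T hT => ?_
  rw [Finset.mem_powerset] at hT
  rw [weightSum, weightSum, Finset.sum_mul_sum, Finset.mul_sum, Finset.mul_sum]
  refine Finset.sum_congr rfl fun w₁ hw₁ => ?_
  rw [Finset.mul_sum, Finset.mul_sum]
  refine Finset.sum_congr rfl fun w₂ hw₂ => ?_
  obtain ⟨n₁, rfl⟩ := mem_arrangements.1 hw₁
  obtain ⟨n₂, e₂⟩ := mem_arrangements.1 hw₂
  have h₁ : ∀ x ∈ w₁, x < m := fun x hx => hS x (hT (by simpa using hx))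
  have h₂ : ∀ x ∈ w₂, x < m := fun x hx => hS x (by
    have : x ∈ S \ w₁.toFinset := by rw [← e₂]; simpa using hx
    exact (Finset.mem_sdiff.1 this).1)
  rw [wordWeight_append _ _ _ _ _ _ _ h₁ h₂ n₁ n₂ (getLastD_ne h₁ hp) (headD_ne h₂ hr), ← e₂]
  simp only [letterWeight, getLastD_lt_iff h₁, headD_lt_iff h₂]

theorem weightSum_empty (u₁ u₂ u₃ u₄ α β q : A) (p r : ℕ) :
    weightSum u₁ u₂ u₃ u₄ α β q p ∅ r = 1 := by
  simp [weightSum, arrangements_empty, wordWeight, tripleCount, leftMaxima, rightMaxima,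
    inversions]

theorem max_strong_induction {motive : Finset ℕ → Prop} (S : Finset ℕ) (empty : motive ∅)
    (insert : ∀ m S, (∀ x ∈ S, x < m) → (∀ T ⊆ S, motive T) → motive (insert m S)) :
    motive S := by
  induction S using Finset.strongInduction with
  | H S ih =>
    rcases S.eq_empty_or_nonempty with rfl | hne
    · exact empty
    · have hm := S.max'_mem hne
      rw [← Finset.insert_erase hm]
      refine insert _ _ (fun x hx => ?_) fun T hT => ih T (hT.trans_ssubset (Finset.erase_ssubset hm))
      exact lt_of_le_of_ne (S.le_max' x (Finset.mem_of_mem_erase hx)) (Finset.ne_of_mem_erase hx)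

/-- Removing the maximum turns `P (n + 1)` into a sum over pairs of words. -/
theorem P_succ_eq_sum (u₁ u₂ u₃ u₄ α β q : A) (n : ℕ) :
    P (n + 1) u₁ u₂ u₃ u₄ α β q =
      ∑ T ∈ (Finset.Icc 1 n).powerset, q ^ crossInversions T (Finset.Icc 1 n \ T) *
        (weightSum u₁ u₂ u₃ u₄ α 1 q 0 T (n + 1) *
          (q ^ (Finset.Icc 1 n \ T).card *
            weightSum u₁ u₂ u₃ u₄ 1 β q (n + 1) (Finset.Icc 1 n \ T) 0)) := by
  have hP : P (n + 1) u₁ u₂ u₃ u₄ α β q = ∑ w ∈ arrangements (Finset.Icc 1 (n + 1)),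
      (u₁ ^ tripleCount IsValley 0 w 0 * u₂ ^ (tripleCount IsPeak 0 w 0 - 1) *
        u₃ ^ tripleCount IsDoubleAscent 0 w 0 * u₄ ^ tripleCount IsDoubleDescent 0 w 0 *
        α ^ (leftMaxima w - 1) * β ^ (rightMaxima w - 1) * q ^ inversions w) := by
    refine Eq.trans ?_ (sum_perm_eq_sum_arrangements _ _)
    simp only [tripleCount_word, leftMaxima_word, rightMaxima_word, inversions_word]
    rfl
  have hS : ∀ x ∈ Finset.Icc 1 n, x < n + 1 := fun x hx => by
    have := (Finset.mem_Icc.1 hx).2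
    omega
  have hI : Finset.Icc 1 (n + 1) = insert (n + 1) (Finset.Icc 1 n) :=
    (Finset.insert_Icc_right_eq_Icc_add_one (by omega)).symm
  rw [hP, hI, sum_arrangements_insert fun h => lt_irrefl _ (hS _ h)]
  generalize Finset.Icc 1 n = S at hS
  have hm : 0 < n + 1 := n.succ_pos
  generalize n + 1 = m at hS hm
  refine Finset.sum_congr rfl fun T hT => ?_
  rw [Finset.mem_powerset] at hT
  rw [weightSum, weightSum, Finset.mul_sum (arrangements (S \ T)), Finset.sum_mul_sum,
    Finset.mul_sum]
  refine Finset.sum_congr rfl fun w₁ hw₁ => ?_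
  rw [Finset.mul_sum]
  refine Finset.sum_congr rfl fun w₂ hw₂ => ?_
  obtain ⟨n₁, rfl⟩ := mem_arrangements.1 hw₁
  obtain ⟨n₂, e₂⟩ := mem_arrangements.1 hw₂
  have h₁ : ∀ x ∈ w₁, x < m := fun x hx => hS x (hT (by simpa using hx))
  have h₂ : ∀ x ∈ w₂, x < m := fun x hx => hS x (by
    have : x ∈ S \ w₁.toFinset := by rw [← e₂]; simpa using hx
    exact (Finset.mem_sdiff.1 this).1)
  have ha : w₁.getLastD 0 < m := (getLastD_lt_iff h₁).2 (Or.inr hm)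
  have hc : w₂.headD 0 < m := (headD_lt_iff h₂).2 (Or.inr hm)
  rw [← e₂]
  simp only [wordWeight, tripleCount_append, leftMaxima_append h₁ h₂, rightMaxima_append h₁ h₂,
    inversions_append h₁ h₂ n₁ n₂, IsValley, IsPeak, IsDoubleAscent, IsDoubleDescent, ha, hc,
    ha.not_gt, hc.not_gt, and_true, and_false, if_true, if_false, one_pow, add_zero,
    Nat.add_sub_cancel, mul_one]
  -- With neighbours below it, `m` is a peak, and the `- 1` in the exponent of `u₂` removes exactly
  -- this one.
  rw [Nat.add_right_comm _ 1, Nat.add_sub_cancel]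
  simp only [pow_add]
  ring

end Weights

/-! ### Generating functions of the weighted sums -/

section GeneratingFunctions

open PowerSeries

variable {L : Type*} [Field L] {q u₁ u₂ u₃ u₄ : L} {f : PowerSeries L}

/-- The summand 1 accounts for the empty word. It is kept apart from `f` because the type of `m`
depends on which sides are empty: none, left, right or both give `u₂`, `u₄`, `u₃`, `u₁`. -/
theorem weightSum_high_high (hq : q ≠ 1) (hf₀ : constantCoeff f = 0)
    (hf : qDeriv q f = C u₁ + C u₄ * rescale q f + C u₃ * f + C u₂ * (f * rescale q f))
    (S : Finset ℕ) {p r : ℕ} (hp : ∀ x ∈ S, x < p) (hr : ∀ x ∈ S, x < r) :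
    weightSum u₁ u₂ u₃ u₄ 1 1 q p S r = qCoeff q S.card 1 + qCoeff q S.card f := by
  induction S using max_strong_induction generalizing p r with
  | empty => simp [weightSum_empty, qCoeff_zero, hf₀]
  | insert m S hS ih =>
    have hmp := hp m (by simp)
    have hmr := hr m (by simp)
    -- The factors 1 stand for an empty side, so that each term becomes a product for
    -- `sum_powerset_qCoeff`.
    have hd : qDeriv q f = C u₁ * (1 * 1) + C u₄ * (1 * rescale q f) + C u₃ * (f * 1) +
        C u₂ * (f * rescale q f) := by rw [hf]; ring
    rw [weightSum_insert _ _ _ _ _ _ _ hS hmp.ne' hmr.ne',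
      Finset.card_insert_of_notMem fun h => lt_irrefl _ (hS m h), qCoeff_one,
      if_neg (by omega), zero_add, qCoeff_succ, hd]
    simp only [qCoeff_add, qCoeff_C_mul]
    simp only [← sum_powerset_qCoeff hq, Finset.mul_sum, ← Finset.sum_add_distrib]
    refine Finset.sum_congr rfl fun T hT => ?_
    rw [Finset.mem_powerset] at hT
    rw [ih T hT (fun x hx => hp x (by simp [hT hx])) (fun x hx => hS x (hT hx)),
      ih (S \ T) Finset.sdiff_subset (fun x hx => hS x (Finset.sdiff_subset hx))
        (fun x hx => hr x (by simp [Finset.sdiff_subset hx]))]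
    simp only [hmp.not_gt, hmr.not_gt, or_false, letterWeight, qCoeff_rescale, qCoeff_one,
      Finset.card_eq_zero, ← Finset.not_nonempty_iff_eq_empty]
    have card_zero : ∀ U : Finset ℕ, ¬U.Nonempty → U.card = 0 := fun U h => by
      rwa [Finset.card_eq_zero, ← Finset.not_nonempty_iff_eq_empty]
    by_cases h₁ : T.Nonempty <;> by_cases h₂ : (S \ T).Nonempty <;>
      simp only [h₁, h₂, if_true, if_false, not_true, not_false_eq_true, card_zero, qCoeff_zero, hf₀,
        pow_zero] <;> ring

/-- The left neighbour of `m` is always smaller, so only `u₃` and `u₂` occur. The left part is again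
of low-high type, while the right part lies between two larger letters and is counted by `1 + f`. -/
theorem weightSum_low_high (hq : q ≠ 1) (hf₀ : constantCoeff f = 0)
    (hf : qDeriv q f = C u₁ + C u₄ * rescale q f + C u₃ * f + C u₂ * (f * rescale q f))
    {α : L} {a : PowerSeries L} (ha₀ : constantCoeff a = 1)
    (ha : qDeriv q a = a * (C α * (C u₃ + C u₂ * rescale q f)))
    (S : Finset ℕ) {p r : ℕ} (hp : ∀ x ∈ S, p < x) (hr : ∀ x ∈ S, x < r) :
    weightSum u₁ u₂ u₃ u₄ α 1 q p S r = qCoeff q S.card a := by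
  induction S using max_strong_induction generalizing p r with
  | empty => simp [weightSum_empty, qCoeff_zero, ha₀]
  | insert m S hS ih =>
    have hmp := hp m (by simp)
    have hmr := hr m (by simp)
    have hd : qDeriv q a = C (α * u₃) * (a * 1) + C (α * u₂) * (a * rescale q f) := by
      rw [ha, map_mul, map_mul]; ring
    rw [weightSum_insert _ _ _ _ _ _ _ hS hmp.ne hmr.ne',
      Finset.card_insert_of_notMem fun h => lt_irrefl _ (hS m h), qCoeff_succ, hd]
    simp only [qCoeff_add, qCoeff_C_mul]
    simp only [← sum_powerset_qCoeff hq, Finset.mul_sum, ← Finset.sum_add_distrib]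
    refine Finset.sum_congr rfl fun T hT => ?_
    rw [Finset.mem_powerset] at hT
    rw [ih T hT (fun x hx => hp x (by simp [hT hx])) (fun x hx => hS x (hT hx)),
      weightSum_high_high hq hf₀ hf (S \ T) (fun x hx => hS x (Finset.sdiff_subset hx))
        (fun x hx => hr x (by simp [Finset.sdiff_subset hx]))]
    simp only [hmp, hmr.not_gt, or_false, or_true, letterWeight, qCoeff_rescale, qCoeff_one,
      Finset.card_eq_zero, ← Finset.not_nonempty_iff_eq_empty, if_true]
    have card_zero : ∀ U : Finset ℕ, ¬U.Nonempty → U.card = 0 := fun U h => by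
      rwa [Finset.card_eq_zero, ← Finset.not_nonempty_iff_eq_empty]
    by_cases h₂ : (S \ T).Nonempty <;>
      simp only [h₂, if_true, if_false, not_true, not_false_eq_true, card_zero, qCoeff_zero, hf₀,
        pow_zero] <;> ring

/-- Mirror image of `weightSum_low_high`, except that `q^|w₂|` now rescales the unknown series `b`
instead of `f`. -/
theorem weightSum_high_low (hq : q ≠ 1) (hf₀ : constantCoeff f = 0)
    (hf : qDeriv q f = C u₁ + C u₄ * rescale q f + C u₃ * f + C u₂ * (f * rescale q f))
    {β : L} {b : PowerSeries L} (hb₀ : constantCoeff b = 1)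
    (hb : qDeriv q b = rescale q b * (C β * (C u₄ + C u₂ * f)))
    (S : Finset ℕ) {p r : ℕ} (hp : ∀ x ∈ S, x < p) (hr : ∀ x ∈ S, r < x) :
    weightSum u₁ u₂ u₃ u₄ 1 β q p S r = qCoeff q S.card b := by
  induction S using max_strong_induction generalizing p r with
  | empty => simp [weightSum_empty, qCoeff_zero, hb₀]
  | insert m S hS ih =>
    have hmp := hp m (by simp)
    have hmr := hr m (by simp)
    have hd : qDeriv q b = C (β * u₄) * (1 * rescale q b) + C (β * u₂) * (f * rescale q b) := by
      rw [hb, map_mul, map_mul]; ring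
    rw [weightSum_insert _ _ _ _ _ _ _ hS hmp.ne' hmr.ne,
      Finset.card_insert_of_notMem fun h => lt_irrefl _ (hS m h), qCoeff_succ, hd]
    simp only [qCoeff_add, qCoeff_C_mul]
    simp only [← sum_powerset_qCoeff hq, Finset.mul_sum, ← Finset.sum_add_distrib]
    refine Finset.sum_congr rfl fun T hT => ?_
    rw [Finset.mem_powerset] at hT
    rw [weightSum_high_high hq hf₀ hf T (fun x hx => hp x (by simp [hT hx]))
        (fun x hx => hS x (hT hx)),
      ih (S \ T) Finset.sdiff_subset (fun x hx => hS x (Finset.sdiff_subset hx))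
        (fun x hx => hr x (by simp [Finset.sdiff_subset hx]))]
    simp only [hmp.not_gt, hmr, or_false, or_true, letterWeight, qCoeff_rescale, qCoeff_one,
      Finset.card_eq_zero, ← Finset.not_nonempty_iff_eq_empty, if_true]
    have card_zero : ∀ U : Finset ℕ, ¬U.Nonempty → U.card = 0 := fun U h => by
      rwa [Finset.card_eq_zero, ← Finset.not_nonempty_iff_eq_empty]
    by_cases h₁ : T.Nonempty <;>
      simp only [h₁, if_true, if_false, not_true, not_false_eq_true, card_zero, qCoeff_zero, hf₀] <;>
      ring

theorem qCoeff_mul_rescale_eq_P (hq : q ≠ 1) (hf₀ : constantCoeff f = 0)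
    (hf : qDeriv q f = C u₁ + C u₄ * rescale q f + C u₃ * f + C u₂ * (f * rescale q f))
    {α β : L} {a b : PowerSeries L} (ha₀ : constantCoeff a = 1) (hb₀ : constantCoeff b = 1)
    (ha : qDeriv q a = a * (C α * (C u₃ + C u₂ * rescale q f)))
    (hb : qDeriv q b = rescale q b * (C β * (C u₄ + C u₂ * f))) (n : ℕ) :
    P (n + 1) u₁ u₂ u₃ u₄ α β q = qCoeff q n (a * rescale q b) := by
  have hn : (Finset.Icc 1 n).card = n := by simp
  have hpos : ∀ x ∈ Finset.Icc 1 n, 0 < x := fun x hx => (Finset.mem_Icc.1 hx).1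
  have hlt : ∀ x ∈ Finset.Icc 1 n, x < n + 1 := fun x hx => by
    have := (Finset.mem_Icc.1 hx).2
    omega
  rw [P_succ_eq_sum]
  conv_rhs => rw [← hn, ← sum_powerset_qCoeff hq]
  refine Finset.sum_congr rfl fun T hT => ?_
  rw [Finset.mem_powerset] at hT
  rw [weightSum_low_high hq hf₀ hf ha₀ ha T (fun x hx => hpos x (hT hx))
      (fun x hx => hlt x (hT hx)),
    weightSum_high_low hq hf₀ hf hb₀ hb _ (fun x hx => hlt x (Finset.sdiff_subset hx))
      (fun x hx => hpos x (Finset.sdiff_subset hx)), qCoeff_rescale]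

/-- Uniqueness comes from the combinatorial model: the coefficients of any solution are the same
weighted sums over words. -/
theorem eq_of_qDeriv_eq (hq1 : q ≠ 1) (hq : ∀ n, ∑ j ∈ Finset.range (n + 1), q ^ j ≠ 0)
    {g : PowerSeries L} (hf₀ : constantCoeff f = 0) (hg₀ : constantCoeff g = 0)
    (hf : qDeriv q f = C u₁ + C u₄ * rescale q f + C u₃ * f + C u₂ * (f * rescale q f))
    (hg : qDeriv q g = C u₁ + C u₄ * rescale q g + C u₃ * g + C u₂ * (g * rescale q g)) :
    f = g := by
  ext n
  have h : ∀ x ∈ Finset.range n, x < n := fun x => Finset.mem_range.1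
  have e := (weightSum_high_high hq1 hf₀ hf _ h h).symm.trans
    (weightSum_high_high hq1 hg₀ hg _ h h)
  rw [Finset.card_range] at e
  exact mul_left_cancel₀ (qFactorial_ne_zero hq n) (add_left_cancel e)

/-- Replacing `t` by `qt` in the Riccati equation for `1/q` exchanges the roles of `u₃` and `u₄` and
restores the equation for `q`; uniqueness concludes. -/
theorem F_inv_eq (hq0 : q ≠ 0) (hq1 : q ≠ 1)
    (hq : ∀ n, ∑ j ∈ Finset.range (n + 1), q ^ j ≠ 0)
    (hq' : ∀ n, ∑ j ∈ Finset.range (n + 1), (q⁻¹) ^ j ≠ 0)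
    {x y : L} (hxy : x ≠ y) (hsum : x + y = u₃ + u₄) (hprod : x * y = u₁ * u₂) :
    F u₁ x y u₃ q⁻¹ = F u₁ x y u₄ q := by
  have hq1' : q⁻¹ ≠ 1 := by simpa using hq1
  have h := (eq_qDeriv_iff hq1').1 (qDeriv_F hq1' hq' hxy (hsum.trans (add_comm _ _)) hprod)
  refine eq_of_qDeriv_eq hq1 hq (constantCoeff_F ..) (constantCoeff_F ..) ?_
    (qDeriv_F hq1 hq hxy hsum hprod)
  rw [eq_qDeriv_iff hq1]
  set f := F u₁ x y u₃ q⁻¹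
  have h' := congrArg (rescale q) h
  have hC : C (q⁻¹ - 1) * (C q * X) = -(C (q - 1) * X : PowerSeries L) := by
    rw [← mul_assoc, ← map_mul, ← neg_mul, ← map_neg]
    congr 2
    field_simp
    ring
  simp only [map_sub, map_mul, map_add, rescale_C, rescale_rescale, rescale_X,
    inv_mul_cancel₀ hq0, rescale_one, RingHom.id_apply] at h' hC ⊢
  rw [hC] at h'
  linear_combination -h'

theorem exists_infiniteProd_eq (v₀ v₁ : Valuation L ℤᵐ⁰) (hq0 : q ≠ 0) (h₀ : v₀ q < 1)
    (h₁ : v₁ q⁻¹ < 1) {x y : L} (α β : L) (hxy : x ≠ y) (hsum : x + y = u₃ + u₄)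
    (hprod : x * y = u₁ * u₂) :
    ∃ A B : PowerSeries L,
      HasInfiniteProd v₀ (leftFactor x y u₁ u₂ u₃ u₄ α q) A ∧
      HasInfiniteProd v₁ (rightFactor x y u₁ u₂ u₃ u₄ β q) B ∧
      mk (fun n : ℕ => P (n + 1) u₁ u₂ u₃ u₄ α β q / qFactorial q n) = A * B := by
  -- A vanishing geometric sum would force `c^(n+1) = 1`, against `v c < 1`.
  have hsumne : ∀ (v : Valuation L ℤᵐ⁰) (c : L), v c < 1 →
      ∀ n, ∑ j ∈ Finset.range (n + 1), c ^ j ≠ 0 := by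
    intro v c hc n h
    have := geom_sum_mul c (n + 1)
    rw [h, zero_mul, eq_comm, sub_eq_zero] at this
    have hlt : v (c ^ (n + 1)) < 1 := by
      rw [map_pow]
      exact pow_lt_one₀ zero_le hc n.succ_ne_zero
    rw [this, map_one] at hlt
    exact lt_irrefl _ hlt
  have hq1 : q ≠ 1 := by
    rintro rfl
    simp at h₀
  have hq := hsumne v₀ q h₀
  have hF := F_inv_eq hq0 hq1 hq (hsumne v₁ _ h₁) hxy hsum hprod
  have hf := qDeriv_F hq1 hq hxy hsum hprod
  have hf₀ := constantCoeff_F u₁ x y u₄ q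
  obtain ⟨a, ha₀, ha⟩ := exists_qDeriv_eq hq 1 (C α * (C u₃ + C u₂ * rescale q (F u₁ x y u₄ q)))
  obtain ⟨b, hb₀, hb⟩ := exists_qDeriv_eq hq q (C β * (C u₄ + C u₂ * F u₁ x y u₄ q))
  rw [rescale_one, RingHom.id_apply] at ha
  -- The second limit is `b(qt)`, not `b(t)`: this is the trace of the inversions between the
  -- maximum and the letters after it.
  refine ⟨a, rescale q b, hasInfiniteProd_of_rescale v₀ h₀ ha₀ fun k => ?_,
    hasInfiniteProd_of_rescale v₁ h₁ (by rw [constantCoeff_rescale, hb₀]) fun k => ?_, ?_⟩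
  · have h := congrArg (rescale (q ^ k)) ((eq_qDeriv_iff hq1).1 ha)
    have hC : C (q - 1) * (C (q ^ k) * X) * C α = -(X * C (α * q ^ k * (1 - q)) : PowerSeries L) := by
      simp only [map_sub, map_mul, map_one]; ring
    simp only [map_sub (rescale _), map_mul (rescale _), map_add (rescale _), rescale_C,
      rescale_rescale, rescale_X, ← pow_succ'] at h
    unfold leftFactor
    set G := C u₃ + C u₂ * rescale (q ^ (k + 1)) (F u₁ x y u₄ q)
    have h' : rescale (q ^ (k + 1)) a =
        (1 - X * C (α * q ^ k * (1 - q)) * G) * rescale (q ^ k) a := by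
      linear_combination h + (rescale (q ^ k) a * G) * hC
    rw [h', ← mul_assoc, PowerSeries.inv_mul_cancel _ (by simp), one_mul]
  · have h := congrArg (rescale (q⁻¹ ^ k)) ((eq_qDeriv_iff hq1).1 hb)
    have hC : C (q - 1) * (C (q⁻¹ ^ k) * X) * C β = (X * C (β / q ^ k * (q - 1)) : PowerSeries L) := by
      rw [div_eq_mul_inv, ← inv_pow]
      simp only [map_sub, map_mul, map_one]; ring
    simp only [map_sub (rescale _), map_mul (rescale _), map_add (rescale _), rescale_C,
      rescale_X] at h
    unfold rightFactor
    -- The stated factor contains `F` at `(u₃, 1/q)`, whereas the equation for `b` contains `F` at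
    -- `(u₄, q)`.
    rw [one_div q, hF, one_div, ← inv_pow]
    set G := C u₄ + C u₂ * rescale (q⁻¹ ^ k) (F u₁ x y u₄ q)
    have h' : rescale (q⁻¹ ^ (k + 1)) (rescale q b) =
        (1 - X * C (β / q ^ k * (q - 1)) * G) * rescale (q⁻¹ ^ k) (rescale q b) := by
      have : rescale (q⁻¹ ^ (k + 1)) (rescale q b) = rescale (q⁻¹ ^ k) b := by
        rw [rescale_rescale, pow_succ', mul_inv_cancel_left₀ hq0]
      rw [this]
      linear_combination -h - (rescale (q⁻¹ ^ k) (rescale q b) * G) * hC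
    rw [h', ← mul_assoc, PowerSeries.inv_mul_cancel _ (by simp), one_mul]
  · ext n
    rw [coeff_mk, qCoeff_mul_rescale_eq_P hq1 hf₀ hf ha₀ hb₀ ha hb, qCoeff,
      mul_div_cancel_left₀ _ (qFactorial_ne_zero hq n)]

end GeneratingFunctions

end StirlingEulerian

open StirlingEulerian in
open RatFunc (C X) in
theorem theorem3 {K : Type*} [Field K] [CharZero K] (x y u₁ u₂ u₃ u₄ α β : K)
    (hxy : x ≠ y) (hsum : x + y = u₃ + u₄) (hprod : x * y = u₁ * u₂) :
    ∃ A B : PowerSeries (RatFunc K),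
      HasInfiniteProd (valZero K)
        (leftFactor (C x) (C y) (C u₁) (C u₂) (C u₃) (C u₄) (C α) (X : RatFunc K)) A ∧
      HasInfiniteProd (valInfty K)
        (rightFactor (C x) (C y) (C u₁) (C u₂) (C u₃) (C u₄) (C β) (X : RatFunc K)) B ∧
      PowerSeries.mk (fun n : ℕ =>
        P (n + 1) (C u₁) (C u₂) (C u₃) (C u₄) (C α) (C β) (X : RatFunc K) /
          qFactorial (X : RatFunc K) n) = A * B := by
  refine exists_infiniteProd_eq _ _ RatFunc.X_ne_zero ?_ ?_ _ _
    (fun h => hxy (RatFunc.C.injective h)) (by rw [← map_add, hsum, map_add])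
    (by rw [← map_mul, hprod, map_mul])
  · rw [valZero, Polynomial.valuation_X_eq_neg_one, ← WithZero.exp_zero, WithZero.exp_lt_exp]
    norm_num
  · rw [valInfty, ← one_div, RatFunc.inftyValuation.X_inv, ← WithZero.exp_zero,
      WithZero.exp_lt_exp]
    norm_num
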